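/- Let $n\ge 0$ be an integer. In the unbiased Avoider–Enforcer non-planarity game on the edge set of the complete graph $K_n$, Avoider and Enforcer alternately claim one previously unclaimed edge of $K_n$ per turn, Avoider going first, until all edges are claimed; Enforcer wins if Avoider's edges form a graph that is not planar. Let $\tau_E(\mathcal{NP}_n)$ be the smallest integer $t$ such that Enforcer has a strategy which guarantees that Avoider's graph is non-planar after at most $t$ moves of Avoider, and $\tau_E(\mathcal{NP}_n)=\infty$ if there is no such $t$. Then $$\tau_E(\mathcal{NP}_n) > 3n-28\sqrt{n}.$$ -/

import Mathlib

/-! ### Unbiased Avoider-Enforcer games on a finite board -/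

section Game

variable {X : Type*}

/-- A strategy of Enforcer on the board `X`: given the list `h` of all elements claimed so far
(by both players, in chronological order), as long as some element is unclaimed it names an
unclaimed element. -/
structure EnforcerStrategy (X : Type*) where
  /-- the answer to a history in which some element is still free -/
  move : ∀ h : List X, (∃ x, x ∉ h) → X
  /-- the answer is a free element -/
  legal : ∀ (h : List X) (hx : ∃ x, x ∉ h), move h hx ∉ h

/-- A complete play of the game: an enumeration without repetition of the whole board.
The players alternate and Avoider starts, so the elements at positions `0, 2, 4, …` are claimed
by Avoider and those at positions `1, 3, 5, …` by Enforcer. -/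
structure IsPlay (l : List X) : Prop where
  nodup : l.Nodup
  complete : ∀ x : X, x ∈ l

/-- In the play `l`, Enforcer makes all his moves according to the strategy `σ`. -/
def EnforcerStrategy.Follows (σ : EnforcerStrategy X) (l : List X) : Prop :=
  ∀ (i : ℕ) (hi : i < l.length), Odd i →
    ∀ hx : ∃ x, x ∉ l.take i, l[i] = σ.move (l.take i) hx

/-- The set of elements that Avoider claims with his first `t` moves in the play `l` (all his
elements, if he makes fewer than `t` moves in the whole play). -/
def avoiderClaims (l : List X) (t : ℕ) : Set X :=
  {x | ∃ i < t, l[2 * i]? = some x}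

/-- Enforcer has a strategy to win the game with family `F` of losing sets within `t` moves:
whatever Avoider does, he has claimed all elements of some member of `F` after (at most)
`t` moves. -/
def EnforcerWinsWithin [Finite X] (F : Set (Set X)) (t : ℕ) : Prop :=
  ∃ σ : EnforcerStrategy X, ∀ l : List X, IsPlay l → σ.Follows l →
    ∃ S ∈ F, S ⊆ avoiderClaims l t

/-- `tauE F` is the smallest `t` such that Enforcer has a strategy to win the game `F` within `t`
moves, and `⊤` if there is no such `t`, that is, if the game is won by Avoider. -/
noncomputable def tauE [Finite X] (F : Set (Set X)) : ℕ∞ :=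
  ⨅ (t : ℕ) (_ : EnforcerWinsWithin F t), (t : ℕ∞)

end Game

/-! ### Planar graphs -/

section Planar

/-- `S` is a simple arc in the plane with end points `x` and `y`. -/
def IsArc (S : Set (ℝ × ℝ)) (x y : ℝ × ℝ) : Prop :=
  ∃ γ : Path x y, Function.Injective γ ∧ Set.range γ = S

/-- A drawing of `G` in the plane: vertices are distinct points, each edge is a simple arc joining
its two ends and containing no other vertex, and distinct edges meet only in vertices.
(The value of `arc` off the edges of `G` is irrelevant.) -/
structure PlaneDrawing {V : Type*} (G : SimpleGraph V) where
  /-- the position of a vertex -/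
  point : V → ℝ × ℝ
  /-- the arc that represents an edge -/
  arc : Sym2 V → Set (ℝ × ℝ)
  point_injective : Function.Injective point
  isArc : ∀ u v, G.Adj u v → IsArc (arc s(u, v)) (point u) (point v)
  eq_or_eq_of_mem : ∀ u v w, G.Adj u v → point w ∈ arc s(u, v) → w = u ∨ w = v
  inter_subset : ∀ e ∈ G.edgeSet, ∀ f ∈ G.edgeSet, e ≠ f → arc e ∩ arc f ⊆ Set.range point

/-- `G` is planar: it can be drawn in the plane without crossings. -/
def IsPlanar {V : Type*} (G : SimpleGraph V) : Prop :=
  Nonempty (PlaneDrawing G)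

end Planar

/-! ### The non-planarity game -/

/-- The edge set of the complete graph on `n` vertices. -/
abbrev CompleteEdges (n : ℕ) : Type :=
  (⊤ : SimpleGraph (Fin n)).edgeSet

/-- The losing sets of the non-planarity game: the edge sets of all non-planar graphs on `n`
vertices. -/
def nonPlanarityGame (n : ℕ) : Set (Set (CompleteEdges n)) :=
  {S | ¬ IsPlanar (SimpleGraph.fromEdgeSet (Subtype.val '' S))}

/-! ### Layered straight-line drawings -/

section Drawing

/-! Avoider maintains a straight-line drawing whose vertices lie on vertical lattice lines. Its
edges join adjacent lines, or consecutive points of one line; if every even line carries at most one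
vertex, nothing crosses (`isPlanar_of_layers`).

Seven vertices are reserved for each of `k` blocks: a center, a column on either side of it, started
by two tips, and a hub beyond each column. All other vertices start idle, that is, isolated in
Avoider's graph. An idle vertex is appended to an end of a column by three edges, to the center, the
hub and the old tip there. Enforcer's reply to the first edge spoils at most one side and his reply
to the second at most one of the two ends, so Avoider completes the triple
(`avoiderCanLast_of_layout`).

The idle vertex must be free of Enforcer edges to the special vertices of the block. Each Enforcer
edge spoils at most one pair (idle vertex, block), so counting provides a good pair (`exists_fresh`)
until about `3n/k` idle vertices remain. The loss of `7k + 3n/k` vertices, at three edges each, is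
nearly minimal for `k ≈ (2/3)√n`. -/

lemma isArc_segment {p q : ℝ × ℝ} (h : p ≠ q) : IsArc (segment ℝ p q) p q := by
  refine ⟨⟨⟨fun t : unitInterval => AffineMap.lineMap p q (t : ℝ), by fun_prop⟩, by simp, by simp⟩,
    fun s t hst => ?_, ?_⟩
  · exact Subtype.ext (AffineMap.lineMap_injective ℝ h hst)
  · rw [segment_eq_image_lineMap]
    ext z
    simp [Set.mem_image]

/-- Two points of unit intervals with integral left ends coincide only in integral points, unless
the intervals are equal. -/
lemma eq_zero_or_one_or_eq {a b : ℤ} {s t : ℝ} (hs : s ∈ Set.Icc (0 : ℝ) 1)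
    (ht : t ∈ Set.Icc (0 : ℝ) 1) (h : (a : ℝ) + s = b + t) : s = 0 ∨ s = 1 ∨ a = b ∧ s = t := by
  obtain ⟨hs0, hs1⟩ := hs
  obtain ⟨ht0, ht1⟩ := ht
  rcases lt_trichotomy a b with hab | hab | hab
  · have : (a : ℝ) + 1 ≤ b := by exact_mod_cast hab
    right; left; linarith
  · subst hab
    exact Or.inr (Or.inr ⟨rfl, by linarith⟩)
  · have : (b : ℝ) + 1 ≤ a := by exact_mod_cast hab
    left; linarith

variable {V : Type*}

/-- The lattice points `u` and `v` are neighbours on a common vertical line, in upward direction,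
or `v` lies on the vertical line next to the one of `u`. -/
def Precedes (x y : V → ℤ) (u v : V) : Prop :=
  (x v = x u ∧ y v = y u + 1) ∨ x v = x u + 1

/-- The point of the plane with the given integral coordinates. -/
def latticePoint (x y : V → ℤ) (v : V) : ℝ × ℝ := ((x v : ℝ), (y v : ℝ))

/-- The straight segment between two lattice points. -/
def latticeArc (x y : V → ℤ) : Sym2 V → Set (ℝ × ℝ) :=
  Sym2.lift ⟨fun u v => segment ℝ (latticePoint x y u) (latticePoint x y v),
    fun _ _ => segment_symm ℝ _ _⟩

lemma exists_of_mem_latticeArc {x y : V → ℤ} {u v : V} {z : ℝ × ℝ}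
    (hz : z ∈ latticeArc x y s(u, v)) : ∃ t ∈ Set.Icc (0 : ℝ) 1,
      z = ((x u : ℝ) + t * (x v - x u), (y u : ℝ) + t * (y v - y u)) := by
  simp only [latticeArc, Sym2.lift_mk, segment_eq_image'] at hz
  obtain ⟨t, ht, rfl⟩ := hz
  exact ⟨t, ht, by simp [latticePoint]⟩

/-- A graph whose vertices are lattice points and whose edges join consecutive points of a vertical
line or points on adjacent vertical lines is planar, if every other line has at most one vertex. -/
theorem isPlanar_of_layers {G : SimpleGraph V} (x y : V → ℤ)
    (inj : ∀ u v, x u = x v → y u = y v → u = v)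
    (even : ∀ u v, Even (x u) → x u = x v → u = v)
    (adj : ∀ u v, G.Adj u v → Precedes x y u v ∨ Precedes x y v u) : IsPlanar G := by
  have pinj : Function.Injective (latticePoint x y) := by
    intro u v h
    simp only [latticePoint, Prod.mk.injEq, Int.cast_inj] at h
    exact inj u v h.1 h.2
  have ends : ∀ {u v : V} {t : ℝ}, t = 0 ∨ t = 1 →
      ((x u : ℝ) + t * (x v - x u), (y u : ℝ) + t * (y v - y u)) = latticePoint x y u ∨
      ((x u : ℝ) + t * (x v - x u), (y u : ℝ) + t * (y v - y u)) = latticePoint x y v := by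
    rintro u v t (rfl | rfl)
    · left; simp [latticePoint]
    · right; simp [latticePoint]
  have hmem : ∀ u v w, Precedes x y u v → latticePoint x y w ∈ latticeArc x y s(u, v) →
      w = u ∨ w = v := by
    intro u v w huv hw
    obtain ⟨t, ht, hz⟩ := exists_of_mem_latticeArc hw
    have h01 : t = 0 ∨ t = 1 := by
      have hz' := hz
      simp only [latticePoint, Prod.mk.injEq] at hz'
      have key : ∀ {a b : ℤ}, (a : ℝ) = b + t → t = 0 ∨ t = 1 := by
        intro a b hab
        rcases eq_zero_or_one_or_eq (a := b) (b := a) (t := 0) ht (by simp) (by linarith) with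
          h | h | h
        · exact Or.inl h
        · exact Or.inr h
        · exact Or.inl h.2
      rcases huv with ⟨-, h2⟩ | h1
      · rw [h2] at hz'
        exact key (a := y w) (b := y u) (by rw [hz'.2]; push_cast; ring)
      · rw [h1] at hz'
        exact key (a := x w) (b := x u) (by rw [hz'.1]; push_cast; ring)
    rcases ends (u := u) (v := v) h01 with h | h
    · exact Or.inl (pinj (hz.trans h))
    · exact Or.inr (pinj (hz.trans h))
  have hinter : ∀ u v u' v', Precedes x y u v → Precedes x y u' v' → s(u, v) ≠ s(u', v') →
      latticeArc x y s(u, v) ∩ latticeArc x y s(u', v') ⊆ Set.range (latticePoint x y) := by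
    rintro u v u' v' huv huv' hne z ⟨hz, hz'⟩
    obtain ⟨t, ht, hz⟩ := exists_of_mem_latticeArc hz
    obtain ⟨s, hs, hz'⟩ := exists_of_mem_latticeArc hz'
    have fin : t = 0 ∨ t = 1 → z ∈ Set.range (latticePoint x y) := by
      intro h
      rcases ends (u := u) (v := v) h with h | h
      · exact ⟨u, (hz.trans h).symm⟩
      · exact ⟨v, (hz.trans h).symm⟩
    have fin' : s = 0 ∨ s = 1 → z ∈ Set.range (latticePoint x y) := by
      intro h
      rcases ends (u := u') (v := v') h with h | h
      · exact ⟨u', (hz'.trans h).symm⟩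
      · exact ⟨v', (hz'.trans h).symm⟩
    have heq := hz.symm.trans hz'
    simp only [Prod.mk.injEq] at heq
    obtain ⟨hx, hy⟩ := heq
    have zero : (0 : ℝ) ∈ Set.Icc (0 : ℝ) 1 := by simp
    rcases huv with ⟨h1, h2⟩ | h1 <;> rcases huv' with ⟨h1', h2'⟩ | h1'
    · have hxx : x u = x u' := by
        rw [h1, h1'] at hx
        simpa using hx
      rw [h2, h2'] at hy
      push_cast at hy
      rcases eq_zero_or_one_or_eq (a := y u) (b := y u') ht hs (by linarith) with h | h | ⟨h, -⟩
      · exact fin (Or.inl h)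
      · exact fin (Or.inr h)
      · have hu : u = u' := inj _ _ hxx h
        have hv : v = v' := inj _ _ (by omega) (by omega)
        exact absurd (by rw [hu, hv]) hne
    -- A vertical edge has integral abscissa, so the slanted one meets it only at an end.
    · rw [h1, h1'] at hx
      push_cast at hx
      rcases eq_zero_or_one_or_eq (a := x u') (b := x u) hs zero (by linarith) with h | h | ⟨-, h⟩
      exacts [fin' (Or.inl h), fin' (Or.inr h), fin' (Or.inl h)]
    · rw [h1, h1'] at hx
      push_cast at hx
      rcases eq_zero_or_one_or_eq (a := x u) (b := x u') ht zero (by linarith) with h | h | ⟨-, h⟩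
      exacts [fin (Or.inl h), fin (Or.inr h), fin (Or.inl h)]
    · rw [h1, h1'] at hx
      push_cast at hx
      rcases eq_zero_or_one_or_eq (a := x u) (b := x u') ht hs (by linarith) with h | h | ⟨h, hts⟩
      · exact fin (Or.inl h)
      · exact fin (Or.inr h)
      subst hts
      -- Two edges across the same strip share their end on the even line, so they meet nowhere
      -- else.
      by_cases hu : Even (x u)
      · have huu : u = u' := even _ _ hu h
        subst huu
        by_cases ht0 : t = 0
        · exact fin (Or.inl ht0)
        have : (y v : ℝ) = y v' := by
          have : t * ((y v : ℝ) - y v') = 0 := by linarith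
          rcases mul_eq_zero.mp this with h | h
          · exact absurd h ht0
          · linarith
        have hv : v = v' := inj _ _ (by omega) (by exact_mod_cast this)
        exact absurd (by rw [hv]) hne
      · have hv : v = v' := even _ _ (by rw [h1]; exact (Int.not_even_iff_odd.mp hu).add_one)
          (by omega)
        subst hv
        by_cases ht1 : t = 1
        · exact fin (Or.inr ht1)
        have : (y u : ℝ) = y u' := by
          have : (1 - t) * ((y u : ℝ) - y u') = 0 := by linarith
          rcases mul_eq_zero.mp this with h | h
          · exact absurd (by linarith) ht1
          · linarith
        have huu : u = u' := inj _ _ h (by exact_mod_cast this)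
        exact absurd (by rw [huu]) hne
  refine ⟨⟨latticePoint x y, latticeArc x y, pinj, ?_, ?_, ?_⟩⟩
  · intro u v huv
    exact isArc_segment fun h => huv.ne (pinj h)
  · intro u v w huv hw
    rcases adj u v huv with h | h
    · exact hmem u v w h hw
    · rw [Sym2.eq_swap] at hw
      exact (hmem v u w h hw).symm
  · have orient : ∀ e ∈ G.edgeSet, ∃ u v, e = s(u, v) ∧ Precedes x y u v := by
      intro e
      induction e using Sym2.ind with
      | _ u v =>
        intro he
        rcases adj u v he with h | h
        · exact ⟨u, v, rfl, h⟩
        · exact ⟨v, u, Sym2.eq_swap, h⟩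
    intro e he f hf hef
    obtain ⟨u, v, rfl, h⟩ := orient e he
    obtain ⟨u', v', rfl, h'⟩ := orient f hf
    exact hinter u v u' v' h h' hef

end Drawing

/-! ### Avoider's side of a finite game -/

section Game

variable {X : Type*}

/-- Avoider, having claimed `A` against `E` and being about to move, can make `m` further moves
(or fill the board) such that his elements satisfy `P` after each of them. -/
def AvoiderCanLast [DecidableEq X] (P : Set X → Prop) : ℕ → Finset X → Finset X → Prop
  | 0, A, _ => P A
  | m + 1, A, E => ∃ x, x ∉ A ∧ x ∉ E ∧ P (insert x A : Finset X) ∧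
      ∀ y, y ∉ insert x A → y ∉ E → AvoiderCanLast P m (insert x A) (insert y E)

lemma EnforcerStrategy.Follows.concat {σ : EnforcerStrategy X} {h : List X} (hσ : σ.Follows h)
    {x : X} (hx : Odd h.length → ∀ hh, x = σ.move h hh) : σ.Follows (h ++ [x]) := by
  intro i hi hodd hfree
  rcases Nat.lt_or_ge i h.length with hlt | hge
  · have ht : (h ++ [x]).take i = h.take i := List.take_append_of_le_length hlt.le
    simp only [ht, List.getElem_append_left hlt]
    exact hσ i hlt hodd (by rwa [ht] at hfree)
  · have hi' : i = h.length := by simp at hi; omega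
    subst hi'
    simp only [List.take_left', List.getElem_concat_length]
    exact hx hodd _

lemma exists_isPlay_extending [Finite X] (σ : EnforcerStrategy X) (h : List X) (hn : h.Nodup)
    (hσ : σ.Follows h) : ∃ l, IsPlay l ∧ σ.Follows l ∧ h <+: l := by
  classical
  have := Fintype.ofFinite X
  induction hm : Fintype.card X - h.length generalizing h with
  | zero =>
    refine ⟨h, ⟨hn, fun x => ?_⟩, hσ, List.prefix_rfl⟩
    have hc : h.toFinset.card = Fintype.card X := by
      apply le_antisymm (Finset.card_le_univ _)
      rw [List.toFinset_card_of_nodup hn]; omega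
    have := (Finset.card_eq_iff_eq_univ _).mp hc
    have hx : x ∈ h.toFinset := by rw [this]; exact Finset.mem_univ _
    simpa using hx
  | succ m ih =>
    by_cases hfree : ∃ x, x ∉ h
    · obtain ⟨x, hx, hmove⟩ : ∃ x, x ∉ h ∧ (Odd h.length → ∀ hh, x = σ.move h hh) :=
        ⟨σ.move h hfree, σ.legal h hfree, fun _ _ => rfl⟩
      obtain ⟨l, h1, h2, h3⟩ := ih (h ++ [x]) (by simp [List.nodup_append, hn]; grind)
        (hσ.concat hmove) (by simp; omega)
      exact ⟨l, h1, h2, (List.prefix_append _ _).trans h3⟩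
    · push Not at hfree
      exact ⟨h, ⟨hn, hfree⟩, hσ, List.prefix_rfl⟩

lemma avoiderClaims_of_prefix {h l : List X} (hl : h <+: l) {t : ℕ} (ht : h.length = 2 * t) :
    avoiderClaims l t = avoiderClaims h t := by
  obtain ⟨r, rfl⟩ := hl
  ext x
  simp only [avoiderClaims, Set.mem_ofPred_eq]
  refine exists_congr fun i => and_congr_right fun hi => ?_
  rw [List.getElem?_append_left (by omega)]

lemma avoiderClaims_concat {h : List X} {s t : ℕ} (hs : h.length = 2 * s) (ht : s < t) (x : X) :
    avoiderClaims (h ++ [x]) t = insert x (avoiderClaims h s) := by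
  ext z
  simp only [avoiderClaims, Set.mem_ofPred_eq, Set.mem_insert_iff]
  constructor
  · rintro ⟨i, hi, hz⟩
    rcases lt_trichotomy i s with his | his | his
    · exact Or.inr ⟨i, his, by rwa [List.getElem?_append_left (by omega)] at hz⟩
    · left
      subst his
      rw [← hs] at hz
      simpa using hz.symm
    · rw [List.getElem?_eq_none (by simp; omega)] at hz
      simp at hz
  · rintro (rfl | ⟨i, hi, hz⟩)
    · exact ⟨s, ht, by rw [← hs]; simp⟩
    · exact ⟨i, hi.trans ht, by rwa [List.getElem?_append_left (by omega)]⟩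

/-- Avoider's recursive guarantee is played out against the fixed strategy `σ`, whose answers
instantiate the quantifier over Enforcer's replies. -/
lemma exists_isPlay_of_avoiderCanLast [DecidableEq X] [Finite X] {P : Set X → Prop} (σ : EnforcerStrategy X)
    (m : ℕ) : ∀ (A E : Finset X) (h : List X) (s : ℕ), h.length = 2 * s → h.Nodup →
      σ.Follows h → (∀ x, x ∈ h ↔ x ∈ A ∨ x ∈ E) → avoiderClaims h s = A →
      AvoiderCanLast P m A E →
      ∃ l, IsPlay l ∧ σ.Follows l ∧ P (avoiderClaims l (s + m)) := by
  induction m with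
  | zero =>
    intro A E h s hs hn hσ _ hA hP
    obtain ⟨l, h1, h2, h3⟩ := exists_isPlay_extending σ h hn hσ
    refine ⟨l, h1, h2, ?_⟩
    rw [Nat.add_zero, avoiderClaims_of_prefix h3 hs, hA]
    exact hP
  | succ m ih =>
    intro A E h s hs hn hσ hmem hA hP
    obtain ⟨x, hxA, hxE, hPx, hP⟩ := hP
    have hxh : x ∉ h := by rw [hmem]; tauto
    have hn' : (h ++ [x]).Nodup := by simp [List.nodup_append, hn]; grind
    have hσ' : σ.Follows (h ++ [x]) := hσ.concat fun hodd => by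
      rw [hs] at hodd; exact absurd hodd (by simp)
    by_cases hfree : ∃ y, y ∉ h ++ [x]
    · have hy := σ.legal _ hfree
      set y := σ.move _ hfree with hy_def
      have hy' : y ∉ h ∧ y ≠ x := by simpa [not_or] using hy
      have hmy := hmem y
      have hcl : avoiderClaims (h ++ [x] ++ [y]) (s + 1) = avoiderClaims (h ++ [x]) (s + 1) := by
        ext z
        simp only [avoiderClaims, Set.mem_ofPred_eq]
        refine exists_congr fun i => and_congr_right fun hi => ?_
        rw [List.getElem?_append_left (by simp; omega)]
      obtain ⟨l, h1, h2, h3⟩ := ih (insert x A) (insert y E) (h ++ [x] ++ [y]) (s + 1)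
        (by simp; omega) (List.nodup_append.mpr ⟨hn', by simp, by simp; grind⟩)
        (hσ'.concat fun _ _ => rfl)
        (fun z => by simp only [List.mem_append, hmem z, Finset.mem_insert]; simp; tauto)
        (by rw [hcl, avoiderClaims_concat hs (by omega), hA]; simp)
        (hP y (by simp; tauto) (by tauto))
      exact ⟨l, h1, h2, by rwa [show s + (m + 1) = s + 1 + m by omega]⟩
    -- The board is full after Avoider's move, so this is already a complete play; that is why
    -- `AvoiderCanLast` demands `P` after every move.
    · push Not at hfree
      refine ⟨h ++ [x], ⟨hn', hfree⟩, hσ', ?_⟩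
      rw [avoiderClaims_concat hs (by omega), hA]
      simpa using hPx

lemma avoiderClaims_mono (l : List X) {s t : ℕ} (h : s ≤ t) :
    avoiderClaims l s ⊆ avoiderClaims l t :=
  fun _ ⟨i, hi, hx⟩ => ⟨i, hi.trans_le h, hx⟩

/-- As `P` passes to subsets, surviving `t` moves rules out an Enforcer win within any `r ≤ t`. -/
theorem add_one_le_tauE_of_avoiderCanLast [DecidableEq X] [Finite X] {P : Set X → Prop}
    (hP : ∀ S T, S ⊆ T → P T → P S) {t : ℕ} (h : AvoiderCanLast P t ∅ ∅) :
    (t : ℕ∞) + 1 ≤ tauE {S | ¬ P S} := by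
  refine le_iInf₂ fun r ⟨σ, hσ⟩ => ?_
  by_contra hr
  have hrt : r ≤ t := by
    have : (r : ℕ∞) < (t + 1 : ℕ) := by push_cast; exact not_le.mp hr
    exact Nat.lt_succ_iff.mp (by exact_mod_cast this)
  obtain ⟨l, h1, h2, h3⟩ := exists_isPlay_of_avoiderCanLast σ t ∅ ∅ [] 0 rfl List.nodup_nil
    (fun i hi => by simp at hi) (by simp) (by simp [avoiderClaims]) h
  obtain ⟨S, hS, hSr⟩ := hσ l h1 h2
  rw [Nat.zero_add] at h3
  exact hS (hP _ _ (hSr.trans (avoiderClaims_mono l hrt)) h3)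

end Game

/-! ### Avoider's drawing -/

section Layout

/-- The sign that belongs to a side (right or left, up or down). -/
def sideSign (s : Bool) : ℤ := if s then 1 else -1

lemma sideSign_cases (s : Bool) :
    s = true ∧ sideSign s = 1 ∨ s = false ∧ sideSign s = -1 := by
  cases s <;> simp [sideSign]

variable {n : ℕ}

/-- A placement of the vertices on lattice points. Block `j < k` occupies the vertical lines `6 * j`
to `6 * j + 4`: its center is alone on the middle line, its two hubs are alone on the outer lines,
and the two other lines have a highest and a lowest vertex, the tips. The line `-1` holds the idle
vertices. -/
structure BlockLayout (n k : ℕ) where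
  x : Fin n → ℤ
  y : Fin n → ℤ
  center : ℕ → Fin n
  hub : ℕ → Bool → Fin n
  tip : ℕ → Bool → Bool → Fin n
  inj : ∀ u v, x u = x v → y u = y v → u = v
  even : ∀ u v, Even (x u) → x u = x v → u = v
  x_center : ∀ j < k, x (center j) = 6 * j + 2
  x_hub : ∀ j < k, ∀ s, x (hub j s) = 6 * j + 2 + 2 * sideSign s
  x_tip : ∀ j < k, ∀ s d, x (tip j s d) = 6 * j + 2 + sideSign s
  y_le : ∀ j < k, ∀ s v, x v = 6 * j + 2 + sideSign s → y v ≤ y (tip j s true)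
  le_y : ∀ j < k, ∀ s v, x v = 6 * j + 2 + sideSign s → y (tip j s false) ≤ y v
  y_lt : ∀ j < k, ∀ s, y (tip j s false) < y (tip j s true)

namespace BlockLayout

variable {k : ℕ} (L : BlockLayout n k)

/-- Avoider's edges are drawn between neighbouring positions and miss the idle vertices. -/
structure Supports (A : Set (CompleteEdges n)) : Prop where
  near : ∀ u v, ∀ e ∈ A, e.1 = s(u, v) → Precedes L.x L.y u v ∨ Precedes L.x L.y v u
  idle : ∀ u, L.x u = -1 → ∀ e ∈ A, u ∉ e.1

/-- The special vertices of a block: its center, hubs and tips. -/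
def Special (j : ℕ) (v : Fin n) : Prop :=
  v = L.center j ∨ (∃ s, v = L.hub j s) ∨ ∃ s d, v = L.tip j s d

variable {L}

lemma Special.x_bounds {j : ℕ} (hj : j < k) {v : Fin n} (h : L.Special j v) :
    6 * (j : ℤ) ≤ L.x v ∧ L.x v ≤ 6 * j + 4 := by
  rcases h with rfl | ⟨s, rfl⟩ | ⟨s, d, rfl⟩
  · rw [L.x_center j hj]; omega
  · rw [L.x_hub j hj]; have := sideSign_cases s; omega
  · rw [L.x_tip j hj]; have := sideSign_cases s; omega

lemma Supports.isPlanar {A : Set (CompleteEdges n)} (h : L.Supports A) :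
    IsPlanar (SimpleGraph.fromEdgeSet (Subtype.val '' A)) := by
  refine isPlanar_of_layers L.x L.y L.inj L.even fun u v huv => ?_
  obtain ⟨⟨e, he, heq⟩, -⟩ := (SimpleGraph.fromEdgeSet_adj _).mp huv
  exact h.near u v e he heq

lemma Supports.insert {A : Set (CompleteEdges n)} (h : L.Supports A) {e : CompleteEdges n}
    {u v : Fin n} (he : e.1 = s(u, v)) (huv : Precedes L.x L.y u v ∨ Precedes L.x L.y v u)
    (hu : L.x u ≠ -1) (hv : L.x v ≠ -1) : L.Supports (insert e A) := by
  refine ⟨?_, ?_⟩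
  · rintro a b f (rfl | hf) hab
    · rw [he, Sym2.eq_iff] at hab
      rcases hab with ⟨rfl, rfl⟩ | ⟨rfl, rfl⟩
      · exact huv
      · exact huv.symm
    · exact h.near a b f hf hab
  · rintro a ha f (rfl | hf) hmem
    · rw [he, Sym2.mem_iff] at hmem
      rcases hmem with rfl | rfl
      · exact hu ha
      · exact hv ha
    · exact h.idle a ha f hf hmem

variable (L)

/-- Move the idle vertex `w` next to the tip `(j, s, d)`; it becomes the new tip. -/
def place {w : Fin n} (hw : L.x w = -1) {j : ℕ} (hj : j < k) (s d : Bool) : BlockLayout n k where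
  x := Function.update L.x w (6 * j + 2 + sideSign s)
  y := Function.update L.y w (L.y (L.tip j s d) + sideSign d)
  center := L.center
  hub := L.hub
  tip := fun j' s' d' => if j' = j ∧ s' = s ∧ d' = d then w else L.tip j' s' d'
  inj := by
    intro u v hx hy
    have hd := sideSign_cases d
    by_cases hu : u = w <;> by_cases hv : v = w
    · rw [hu, hv]
    -- Every old vertex of the column lies between its tips, while `w` lies strictly beyond one of
    -- them.
    · rw [hu, Function.update_self, Function.update_of_ne hv] at hx hy
      have h1 := L.y_le j hj s v hx.symm
      have h2 := L.le_y j hj s v hx.symm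
      rcases hd with ⟨rfl, h⟩ | ⟨rfl, h⟩ <;> omega
    · rw [hv, Function.update_self, Function.update_of_ne hu] at hx hy
      have h1 := L.y_le j hj s u hx
      have h2 := L.le_y j hj s u hx
      rcases hd with ⟨rfl, h⟩ | ⟨rfl, h⟩ <;> omega
    · rw [Function.update_of_ne hu, Function.update_of_ne hv] at hx hy
      exact L.inj u v hx hy
  even := by
    intro u v he hx
    have hs := sideSign_cases s
    by_cases hu : u = w <;> by_cases hv : v = w
    · rw [hu, hv]
    -- The new line of `w` is odd.
    · rw [hu, Function.update_self, Int.even_iff] at he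
      omega
    · rw [hx, hv, Function.update_self, Int.even_iff] at he
      omega
    · rw [Function.update_of_ne hu] at he hx
      rw [Function.update_of_ne hv] at hx
      exact L.even u v he hx
  x_center := by
    intro i hi
    have h := L.x_center i hi
    rwa [Function.update_of_ne (by rintro h'; rw [h'] at h; omega)]
  x_hub := by
    intro i hi t
    have h := L.x_hub i hi t
    have ht := sideSign_cases t
    rwa [Function.update_of_ne (by rintro h'; rw [h'] at h; omega)]
  x_tip := by
    intro i hi t c
    split_ifs with h
    · rw [Function.update_self, h.1, h.2.1]
    · have h := L.x_tip i hi t c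
      have ht := sideSign_cases t
      rwa [Function.update_of_ne (by rintro h'; rw [h'] at h; omega)]
  y_le := by
    intro i hi t v hv
    have ht := sideSign_cases t
    have hs := sideSign_cases s
    have hd := sideSign_cases d
    have hx := L.x_tip i hi t true
    have hlt := L.y_lt i hi t
    have hne : L.tip i t true ≠ w := by rintro h'; rw [h'] at hx; omega
    by_cases hvw : v = w
    · subst hvw
      rw [Function.update_self] at hv ⊢
      obtain rfl : i = j := by omega
      obtain rfl : t = s := by grind
      cases d
      · simp [Function.update_of_ne hne, sideSign]; omega
      · simp
    · rw [Function.update_of_ne hvw] at hv ⊢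
      have := L.y_le i hi t v hv
      split_ifs with h
      · obtain ⟨rfl, rfl, rfl⟩ := h
        have : sideSign true = 1 := rfl
        rw [Function.update_self]; omega
      · rwa [Function.update_of_ne hne]
  le_y := by
    intro i hi t v hv
    have ht := sideSign_cases t
    have hs := sideSign_cases s
    have hd := sideSign_cases d
    have hx := L.x_tip i hi t false
    have hlt := L.y_lt i hi t
    have hne : L.tip i t false ≠ w := by rintro h'; rw [h'] at hx; omega
    by_cases hvw : v = w
    · subst hvw
      rw [Function.update_self] at hv ⊢
      obtain rfl : i = j := by omega
      obtain rfl : t = s := by grind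
      cases d
      · simp
      · simp [Function.update_of_ne hne, sideSign]; omega
    · rw [Function.update_of_ne hvw] at hv ⊢
      have := L.le_y i hi t v hv
      split_ifs with h
      · obtain ⟨rfl, rfl, rfl⟩ := h
        have : sideSign false = -1 := rfl
        rw [Function.update_self]; omega
      · rwa [Function.update_of_ne hne]
  y_lt := by
    intro i hi t
    have hlt := L.y_lt i hi t
    have ht := sideSign_cases t
    have hne : ∀ c, L.tip i t c ≠ w := by
      rintro c h'
      have hx := L.x_tip i hi t c
      rw [h'] at hx; omega
    by_cases h : i = j ∧ t = s
    · obtain ⟨rfl, rfl⟩ := h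
      cases d <;> simp [Function.update_of_ne (hne _), sideSign] <;> omega
    · rw [if_neg (by tauto), if_neg (by tauto), Function.update_of_ne (hne _),
        Function.update_of_ne (hne _)]
      exact hlt

variable {L}

section Place

variable {w : Fin n} (hw : L.x w = -1) {j : ℕ} (hj : j < k) (s d : Bool)

lemma place_x_self : (L.place hw hj s d).x w = 6 * j + 2 + sideSign s := Function.update_self ..

lemma place_x_of_ne {v : Fin n} (hv : v ≠ w) : (L.place hw hj s d).x v = L.x v :=
  Function.update_of_ne hv ..

lemma place_y_self : (L.place hw hj s d).y w = L.y (L.tip j s d) + sideSign d :=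
  Function.update_self ..

lemma place_y_of_ne {v : Fin n} (hv : v ≠ w) : (L.place hw hj s d).y v = L.y v :=
  Function.update_of_ne hv ..

/-- Idle vertices are isolated, so moving one disturbs no edge. -/
lemma Supports.place {A : Set (CompleteEdges n)} (h : L.Supports A) :
    (L.place hw hj s d).Supports A := by
  refine ⟨?_, ?_⟩
  · intro u v e he heq
    have hu : u ≠ w := by
      rintro rfl
      exact h.idle u hw e he (by rw [heq]; exact Sym2.mem_mk_left _ _)
    have hv : v ≠ w := by
      rintro rfl
      exact h.idle v hw e he (by rw [heq]; exact Sym2.mem_mk_right _ _)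
    have := h.near u v e he heq
    simpa only [Precedes, place_x_of_ne hw hj s d hu, place_x_of_ne hw hj s d hv,
      place_y_of_ne hw hj s d hu, place_y_of_ne hw hj s d hv] using this
  · intro u hu e he
    by_cases huw : u = w
    · rw [huw]; exact h.idle w hw e he
    · rw [place_x_of_ne hw hj s d huw] at hu
      exact h.idle u hu e he

lemma Special.ne {v w : Fin n} {j : ℕ} (hv : L.Special j v) (hw : L.x w = -1) (hj : j < k) :
    v ≠ w := by
  rintro rfl
  have := hv.x_bounds hj
  omega

/-- After `w` has been placed, it is a neighbour of the center, of the hub on its side, and of the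
previous tip. -/
lemma Supports.insert_place {A : Set (CompleteEdges n)} (h : (L.place hw hj s d).Supports A)
    {v : Fin n} (hv : v = L.center j ∨ v = L.hub j s ∨ v = L.tip j s d) {e : CompleteEdges n}
    (he : e.1 = s(w, v)) : (L.place hw hj s d).Supports (Insert.insert e A) := by
  have hsp : L.Special j v := by
    rcases hv with h | h | h
    exacts [Or.inl h, Or.inr (Or.inl ⟨_, h⟩), Or.inr (Or.inr ⟨_, _, h⟩)]
  have hvw := hsp.ne hw hj
  have hb := hsp.x_bounds hj
  have hs := sideSign_cases s
  have hd := sideSign_cases d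
  refine h.insert he ?_ (by rw [place_x_self]; omega) (by rw [place_x_of_ne _ _ _ _ hvw]; omega)
  simp only [Precedes, place_x_self, place_y_self, place_x_of_ne hw hj s d hvw,
    place_y_of_ne hw hj s d hvw]
  rcases hv with rfl | rfl | rfl
  · have := L.x_center j hj; omega
  · have := L.x_hub j hj s; omega
  · have := L.x_tip j hj s d; omega

end Place

/-- If Enforcer has few edges, then some idle vertex is joined by none of them to the special
vertices of some block. -/
lemma exists_fresh (E : Finset (CompleteEdges n))
    (hE : E.card < (Finset.univ.filter fun w => L.x w = -1).card * k) :
    ∃ w j, L.x w = -1 ∧ j < k ∧ ∀ v, L.Special j v → ∀ e ∈ E, e.1 ≠ s(w, v) := by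
  by_contra! hcon
  refine absurd hE (not_lt.mpr ?_)
  set U := Finset.univ.filter fun w => L.x w = -1
  have hcard : (U ×ˢ Finset.range k).card = U.card * k := by
    rw [Finset.card_product, Finset.card_range]
  rw [← hcard]
  have hch : ∀ p : Fin n × ℕ, p ∈ U ×ˢ Finset.range k →
      ∃ e ∈ E, ∃ v, L.Special p.2 v ∧ e.1 = s(p.1, v) := by
    intro p hp
    simp only [Finset.mem_product, Finset.mem_range, U, Finset.mem_filter, Finset.mem_univ,
      true_and] at hp
    obtain ⟨v, hv, e, he, heq⟩ := hcon p.1 p.2 hp.1 hp.2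
    exact ⟨e, he, v, hv, heq⟩
  rcases (U ×ˢ Finset.range k).eq_empty_or_nonempty with h0 | ⟨p₀, hp₀⟩
  · simp [h0]
  have : Nonempty (CompleteEdges n) := ⟨(hch p₀ hp₀).choose⟩
  have : Nonempty (Fin n) := ⟨p₀.1⟩
  choose! f hf g hg hfg using hch
  -- A blocking edge determines its pair: its idle end is the one on line `-1`, and the abscissa of
  -- the other end gives the block.
  refine Finset.card_le_card_of_injOn f (fun p hp => hf p hp) ?_
  intro p hp q hq hpq
  have h1 := hfg p hp
  rw [hpq, hfg q hq, Sym2.eq_iff] at h1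
  have hgp := hg p hp
  have hgq := hg q hq
  simp only [Finset.coe_product, Set.mem_prod, Finset.mem_coe, Finset.mem_range, U,
    Finset.mem_filter, Finset.mem_univ, true_and] at hp hq
  have hbp := hgp.x_bounds hp.2
  have hbq := hgq.x_bounds hq.2
  rcases h1 with ⟨h1, h2⟩ | ⟨h1, h2⟩
  · rw [h2] at hbq
    exact Prod.ext h1.symm (by omega)
  · rw [← h1] at hbp
    omega

lemma card_idle_place {w : Fin n} (hw : L.x w = -1) {j : ℕ} (hj : j < k) (s d : Bool) :
    (Finset.univ.filter fun v => L.x v = -1).card ≤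
      (Finset.univ.filter fun v => (L.place hw hj s d).x v = -1).card + 1 := by
  rw [← Finset.card_erase_add_one (a := w) (by simp [hw])]
  refine Nat.add_le_add_right (Finset.card_le_card fun v hv => ?_) 1
  simp only [Finset.mem_erase, Finset.mem_filter, Finset.mem_univ, true_and] at hv ⊢
  rw [place_x_of_ne _ _ _ _ hv.1]
  exact hv.2

end BlockLayout

/-- In three moves Avoider joins a fresh idle vertex to the center of a block, to one of its hubs,
and to a tip on the side of this hub. -/
theorem avoiderCanLast_of_layout {k : ℕ} (T : ℕ) : ∀ (L : BlockLayout n k)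
    (A E : Finset (CompleteEdges n)), L.Supports (A : Set (CompleteEdges n)) →
    (∀ i < T, E.card + 3 * i < ((Finset.univ.filter fun w => L.x w = -1).card - i) * k) →
    AvoiderCanLast (fun S : Set (CompleteEdges n) =>
      IsPlanar (SimpleGraph.fromEdgeSet (Subtype.val '' S))) (3 * T) A E := by
  induction T with
  | zero => exact fun L A E hA _ => hA.isPlanar
  | succ T ih =>
    intro L A E hA hcount
    obtain ⟨w, j, hw, hj, hfresh⟩ := L.exists_fresh E (by simpa using hcount 0 (by omega))
    have hedge : ∀ v, L.Special j v → ∃ e : CompleteEdges n, e.1 = s(w, v) := fun v hv =>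
      ⟨⟨s(w, v), by simpa using (hv.ne hw hj).symm⟩, rfl⟩
    have : Nonempty (CompleteEdges n) := ⟨(hedge _ (Or.inl rfl)).choose⟩
    choose! f hf using hedge
    have hinj : ∀ u v, L.Special j u → L.Special j v → f u = f v → u = v := by
      intro u v hu hv huv
      have h := hf u hu
      rw [huv, hf v hv] at h
      exact (Sym2.congr_right.mp h).symm
    have hfA : ∀ v, L.Special j v → f v ∉ A := fun v hv h =>
      hA.idle w hw _ h (by rw [hf v hv]; exact Sym2.mem_mk_left _ _)
    have hfE : ∀ v, L.Special j v → f v ∉ E := fun v hv h => hfresh v hv _ h (hf v hv)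
    have sc : L.Special j (L.center j) := Or.inl rfl
    have sh : ∀ s, L.Special j (L.hub j s) := fun s => Or.inr (Or.inl ⟨s, rfl⟩)
    have st : ∀ s d, L.Special j (L.tip j s d) := fun s d => Or.inr (Or.inr ⟨s, d, rfl⟩)
    have hch : ∀ s, L.center j ≠ L.hub j s := fun s h => by
      have h1 := L.x_center j hj
      have h2 := L.x_hub j hj s
      have := sideSign_cases s
      rw [h] at h1; omega
    have hct : ∀ s d, L.center j ≠ L.tip j s d := fun s d h => by
      have h1 := L.x_center j hj
      have h2 := L.x_tip j hj s d
      have := sideSign_cases s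
      rw [h] at h1; omega
    have hht : ∀ s s' d, L.hub j s ≠ L.tip j s' d := fun s s' d h => by
      have h1 := L.x_hub j hj s
      have h2 := L.x_tip j hj s' d
      have := sideSign_cases s
      have := sideSign_cases s'
      rw [h] at h1; omega
    have hhh : L.hub j true ≠ L.hub j false := fun h => by
      have h1 := L.x_hub j hj true
      have h2 := L.x_hub j hj false
      simp only [sideSign] at h1 h2
      rw [h] at h1; simp at h1 h2; omega
    have htt : ∀ d d', L.tip j true d ≠ L.tip j false d' := fun d d' h => by
      have h1 := L.x_tip j hj true d
      have h2 := L.x_tip j hj false d'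
      simp only [sideSign] at h1 h2
      rw [h] at h1; simp at h1 h2; omega
    have htt' : ∀ s, L.tip j s true ≠ L.tip j s false := fun s h => by
      have := L.y_lt j hj s
      rw [h] at this; omega
    -- Proved for all four positions: the side and the end are chosen only after Enforcer's replies.
    have hsup : ∀ s d, (L.place hw hj s d).Supports
        (insert (f (L.center j)) A : Finset (CompleteEdges n)) := fun s d => by
      rw [Finset.coe_insert]
      exact (hA.place hw hj s d).insert_place hw hj s d (Or.inl rfl) (hf _ sc)
    have hsup' : ∀ s d, (L.place hw hj s d).Supports
        (insert (f (L.hub j s)) (insert (f (L.center j)) A) : Finset (CompleteEdges n)) :=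
      fun s d => by
      rw [Finset.coe_insert]
      exact (hsup s d).insert_place hw hj s d (Or.inr (Or.inl rfl)) (hf _ (sh s))
    have hsup'' : ∀ s d, (L.place hw hj s d).Supports
        (insert (f (L.tip j s d)) (insert (f (L.hub j s)) (insert (f (L.center j)) A)) :
          Finset (CompleteEdges n)) := fun s d => by
      rw [Finset.coe_insert]
      exact (hsup' s d).insert_place hw hj s d (Or.inr (Or.inr rfl)) (hf _ (st s d))
    refine ⟨f (L.center j), hfA _ sc, hfE _ sc, (hsup true true).isPlanar, fun y₁ _ _ => ?_⟩
    -- The hub and tip edges of the two sides are distinct, so `y₁` leaves one side untouched.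
    obtain ⟨s, hs, hs'⟩ : ∃ s, y₁ ≠ f (L.hub j s) ∧ ∀ d, y₁ ≠ f (L.tip j s d) := by
      by_cases h : y₁ ≠ f (L.hub j true) ∧ ∀ d, y₁ ≠ f (L.tip j true d)
      · exact ⟨true, h⟩
      refine ⟨false, ?_, ?_⟩
      · rintro rfl
        exact h ⟨fun h => hhh (hinj _ _ (sh _) (sh _) h).symm,
          fun d h => hht _ _ _ (hinj _ _ (sh _) (st _ _) h)⟩
      · rintro d rfl
        exact h ⟨fun h => hht _ _ _ (hinj _ _ (st _ _) (sh _) h).symm,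
          fun d h => htt _ _ (hinj _ _ (st _ _) (st _ _) h).symm⟩
    refine ⟨f (L.hub j s), ?_, ?_, (hsup' s true).isPlanar, fun y₂ _ _ => ?_⟩
    · rw [Finset.mem_insert, not_or]
      exact ⟨fun h => hch _ (hinj _ _ (sh _) sc h).symm, hfA _ (sh s)⟩
    · rw [Finset.mem_insert, not_or]
      exact ⟨hs.symm, hfE _ (sh s)⟩
    obtain ⟨d, hd⟩ : ∃ d, y₂ ≠ f (L.tip j s d) := by
      by_contra! h
      exact htt' s (hinj _ _ (st _ _) (st _ _) ((h true).symm.trans (h false)))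
    refine ⟨f (L.tip j s d), ?_, ?_, (hsup'' s d).isPlanar, fun y₃ _ _ => ?_⟩
    · simp only [Finset.mem_insert, not_or]
      exact ⟨fun h => hht _ _ _ (hinj _ _ (st _ _) (sh _) h).symm,
        fun h => hct _ _ (hinj _ _ (st _ _) sc h).symm, hfA _ (st s d)⟩
    · simp only [Finset.mem_insert, not_or]
      exact ⟨hd.symm, (hs' d).symm, hfE _ (st s d)⟩
    -- A round adds at most three Enforcer edges and uses one idle vertex, which shifts the index in
    -- `hcount` by one.
    refine ih (L.place hw hj s d) _ _ (hsup'' s d) fun i hi => ?_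
    have hc1 := hcount (i + 1) (by omega)
    have hc2 := L.card_idle_place hw hj s d
    have hc3 : (insert y₃ (insert y₂ (insert y₁ E))).card ≤ E.card + 3 := by
      have h1 := Finset.card_insert_le y₁ E
      have h2 := Finset.card_insert_le y₂ (insert y₁ E)
      have h3 := Finset.card_insert_le y₃ (insert y₂ (insert y₁ E))
      omega
    calc _ ≤ E.card + 3 * (i + 1) := by omega
      _ < _ := hc1
      _ ≤ _ := Nat.mul_le_mul_right k (by omega)

/-- The layout in which the first `7 * k` vertices are the special ones and the others are idle. -/
def initialLayout {n k : ℕ} (h : 7 * k ≤ n) (hn : 0 < n) : BlockLayout n k where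
  -- Residues mod 7, from left to right: hub, two left tips, center, two right tips, hub.
  x v := if v.1 < 7 * k then
      6 * ((v.1 / 7 : ℕ) : ℤ) + (if v.1 % 7 ≤ 1 then (v.1 % 7 : ℕ) else
        if v.1 % 7 = 2 then 1 else if v.1 % 7 = 3 then 2 else if v.1 % 7 ≤ 5 then 3 else 4)
    else -1
  y v := if v.1 < 7 * k then (if v.1 % 7 = 2 ∨ v.1 % 7 = 5 then 1 else 0) else v.1
  -- The reduction mod `n` only serves the irrelevant `j ≥ k`.
  center j := ⟨(7 * j + 3) % n, Nat.mod_lt _ hn⟩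
  hub j s := ⟨(7 * j + if s then 6 else 0) % n, Nat.mod_lt _ hn⟩
  tip j s d := ⟨(7 * j + (if s then 4 else 1) + if d then 1 else 0) % n, Nat.mod_lt _ hn⟩
  inj := by
    intro u v hx hy
    apply Fin.ext
    grind
  even := by
    intro u v hu hx
    apply Fin.ext
    rw [Int.even_iff] at hu
    grind
  x_center := by
    intro j hj
    simp only [Nat.mod_eq_of_lt (show 7 * j + 3 < n by omega)]
    grind
  x_hub := by
    intro j hj s
    have := Nat.mod_eq_of_lt (a := 7 * j + if s then 6 else 0) (b := n) (by split_ifs <;> omega)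
    simp only [this, sideSign]
    cases s <;> simp only [if_true, Bool.false_eq_true, if_false] <;> grind
  x_tip := by
    intro j hj s d
    have := Nat.mod_eq_of_lt (a := 7 * j + (if s then 4 else 1) + if d then 1 else 0) (b := n)
      (by split_ifs <;> omega)
    simp only [this, sideSign]
    cases s <;> cases d <;> simp only [if_true, Bool.false_eq_true, if_false] <;> grind
  y_le := by
    intro j hj s v hv
    have := Nat.mod_eq_of_lt (a := 7 * j + (if s then 4 else 1) + if true then 1 else 0) (b := n)
      (by split_ifs <;> omega)
    simp only
    cases s <;> simp only [sideSign, if_true, Bool.false_eq_true, if_false] at hv ⊢ <;> grind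
  le_y := by
    intro j hj s v hv
    have := Nat.mod_eq_of_lt (a := 7 * j + (if s then 4 else 1) + if false then 1 else 0) (b := n)
      (by split_ifs <;> simp_all <;> omega)
    simp only [this]
    cases s <;> simp only [sideSign, if_true, Bool.false_eq_true, if_false] at hv ⊢ <;> grind
  y_lt := by
    intro j hj s
    have h1 := Nat.mod_eq_of_lt (a := 7 * j + (if s then 4 else 1) + if true then 1 else 0) (b := n)
      (by split_ifs <;> omega)
    have h2 := Nat.mod_eq_of_lt (a := 7 * j + (if s then 4 else 1) + if false then 1 else 0)
      (b := n) (by split_ifs <;> simp_all <;> omega)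
    simp only [h2]
    cases s <;> simp only [if_true, Bool.false_eq_true, if_false] <;> grind

lemma card_idle_initialLayout {n k : ℕ} (h : 7 * k ≤ n) (hn : 0 < n) :
    n - 7 * k ≤ (Finset.univ.filter fun w => (initialLayout h hn).x w = -1).card := by
  have : (Finset.univ.filter fun w : Fin n => w.1 < 7 * k).card ≤ 7 * k := by
    rw [← Finset.card_range (7 * k)]
    exact Finset.card_le_card_of_injOn (fun w => w.1) (fun w hw => by simpa using hw)
      (fun a _ b _ hab => Fin.ext hab)
  have hadd := Finset.card_filter_add_card_filter_not (s := (Finset.univ : Finset (Fin n)))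
    (fun w : Fin n => w.1 < 7 * k)
  rw [Finset.card_univ, Fintype.card_fin] at hadd
  have hle : (Finset.univ.filter fun w : Fin n => ¬ w.1 < 7 * k).card ≤
      (Finset.univ.filter fun w => (initialLayout h hn).x w = -1).card := by
    refine Finset.card_le_card fun w hw => ?_
    simp only [Finset.mem_filter, Finset.mem_univ, true_and] at hw ⊢
    simp only [initialLayout]
    rw [if_neg hw]
  omega

end Layout

/-! ### Choice of parameters and conclusion -/

lemma IsPlanar.mono {V : Type*} {G H : SimpleGraph V} (h : G ≤ H) (hH : IsPlanar H) :
    IsPlanar G := by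
  obtain ⟨D⟩ := hH
  exact ⟨⟨D.point, D.arc, D.point_injective, fun u v huv => D.isArc u v (h huv),
    fun u v w huv => D.eq_or_eq_of_mem u v w (h huv),
    fun e he f hf => D.inter_subset e (SimpleGraph.edgeSet_mono h he) f
      (SimpleGraph.edgeSet_mono h hf)⟩⟩

theorem avoiderCanLast_nonPlanarity (n : ℕ) :
    AvoiderCanLast (fun S : Set (CompleteEdges n) =>
      IsPlanar (SimpleGraph.fromEdgeSet (Subtype.val '' S)))
      (3 * ⌈(n : ℝ) - 28 / 3 * √n⌉₊) ∅ ∅ := by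
  set r := √(n : ℝ)
  have hr : r ^ 2 = n := Real.sq_sqrt n.cast_nonneg
  have hr0 : 0 ≤ r := Real.sqrt_nonneg _
  set T := ⌈(n : ℝ) - 28 / 3 * r⌉₊ with hT
  set k := ⌊2 / 3 * r⌋₊ with hk
  have hk1 : (k : ℝ) ≤ 2 / 3 * r := Nat.floor_le (by positivity)
  have hk2 : 2 / 3 * r < k + 1 := Nat.lt_floor_add_one _
  rcases Nat.eq_zero_or_pos T with hT0 | hT0
  · rw [hT0]
    have : SimpleGraph.fromEdgeSet
        (Subtype.val '' ((∅ : Finset (CompleteEdges n)) : Set (CompleteEdges n))) = ⊥ := by simp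
    change IsPlanar _
    rw [this]
    -- All vertices go on one odd line, where the condition on even lines is void.
    exact isPlanar_of_layers (fun _ => 1) (fun v : Fin n => (v : ℤ))
      (fun u v _ h => Fin.ext (by exact_mod_cast h)) (fun _ _ h => absurd h (by decide))
      (fun _ _ h => h.elim)
  have hpos : (0 : ℝ) < n - 28 / 3 * r := Nat.ceil_pos.mp hT0
  have hr1 : 28 / 3 < r := by nlinarith
  have h7 : 7 * k ≤ n := by
    have : (7 * k : ℝ) ≤ n := by nlinarith
    exact_mod_cast this
  have hn : 0 < n := by
    have : (0 : ℝ) < n := by nlinarith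
    exact_mod_cast this
  refine avoiderCanLast_of_layout T (initialLayout h7 hn) ∅ ∅ ⟨by simp, by simp⟩ fun i hi => ?_
  have hi' : (i : ℝ) < n - 28 / 3 * r := Nat.lt_ceil.mp hi
  have hi7 : 7 * k + i ≤ n := by
    have : (7 * k + i : ℝ) ≤ n := by linarith
    exact_mod_cast this
  -- With `r = √n`, more than `(28/3 - 14/3) r` idle vertices remain and `k > (2/3) r - 1`. The
  -- product exceeds `(28/9) r² - (14/3) r`, hence `3r² - 28r`, which is more than `3i`.
  have hmain : 3 * i < (n - 7 * k - i) * k := by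
    have h1 : n - 7 * k - i = n - (7 * k + i) := by omega
    rw [h1]
    have : (3 * i : ℝ) < ((n - (7 * k + i) : ℕ) : ℝ) * k := by
      rw [Nat.cast_sub hi7]
      push_cast
      nlinarith
    exact_mod_cast this
  have hc := card_idle_initialLayout h7 hn
  rw [Finset.card_empty, Nat.zero_add]
  exact hmain.trans_le (Nat.mul_le_mul_right k (by omega))

theorem theorem1 (n : ℕ) :
    ((3 * (n : ℝ) - 28 * Real.sqrt (n : ℝ) : ℝ) : EReal) <
      ((tauE (nonPlanarityGame n) : ENNReal) : EReal) := by
  have h := add_one_le_tauE_of_avoiderCanLast (fun S T hST hT => IsPlanar.mono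
    (SimpleGraph.fromEdgeSet_mono (Set.image_mono hST)) hT) (avoiderCanLast_nonPlanarity n)
  set t := 3 * ⌈(n : ℝ) - 28 / 3 * √n⌉₊ with ht
  have h' : ((t + 1 : ℕ) : ℕ∞) ≤ tauE (nonPlanarityGame n) := by exact_mod_cast h
  have hlt : 3 * (n : ℝ) - 28 * √n < ((t + 1 : ℕ) : ℝ) := by
    have := Nat.le_ceil ((n : ℝ) - 28 / 3 * √n)
    rw [ht]
    push_cast
    linarith
  calc ((3 * (n : ℝ) - 28 * √n : ℝ) : EReal) < (((t + 1 : ℕ) : ℝ) : EReal) :=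
        EReal.coe_lt_coe_iff.mpr hlt
    _ = ((((t + 1 : ℕ) : ℕ∞) : ENNReal) : EReal) := by simp; rfl
    _ ≤ _ := by
      rw [EReal.coe_ennreal_le_coe_ennreal_iff]
      exact ENat.toENNReal_mono h'
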